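/- Let $(P,\omega)$ be a smooth symplectic manifold of dimension $2N$ (phase space), with Poisson bracket $[G,F]=V_G(F)$, where $dG=\omega(V_G,\cdot)$. Let a gauge theory in Hamiltonian form be given on $P$: a smooth Hamiltonian $H$ and $L$ smooth constraints $\mathcal C^1,\dots,\mathcal C^L$ such that, on the constraint manifold $\{\mathcal C^1=\dots=\mathcal C^L=0\}$, the differentials $d\mathcal C^A$ are linearly independent (irreducibility), $[\mathcal C^A,\mathcal C^B]=0$ (first class) and $[\mathcal C^A,H]=0$. Suppose that the gauge freedom is completely fixed through the Dirac bracket on an open region $U\subseteq P$: there are smooth functions $\mathcal S_1,\dots,\mathcal S_L$ on $U$ such that the commutation matrix $D_{AB}=[\mathcal D_A,\mathcal D_B]$ of all $2L$ constraints $\mathcal D=(\mathcal C^1,\dots,\mathcal C^L,\mathcal S_1,\dots,\mathcal S_L)$ is invertible at every point of $U$. Let $\Sigma_P=\{z\in U : \mathcal D_A(z)=0 \text{ for all } A\}$ (the physical phase space) be non-empty. Then: 1. At every point of $U$ each constraint $\mathcal D_A$ is second class, i.e. it has non-zero bracket with some other $\mathcal D_B$, and the Dirac bracket $[F,G]_D=[F,G]-\sum_{A,B}[F,\mathcal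 D_A](D^{-1})_{AB}[\mathcal D_B,G]$ satisfies $[F,\mathcal D_A]_D=0$ on $U$ for every function $F$ and every $A$. 2. The exact Pfaffian forms $\theta^A=d\mathcal C^A$, $\theta_B=d\mathcal S_B$ are linearly independent at every point of $U$; the ideal $\mathcal I$ they generate in the algebra of smooth differential forms on $U$ is a differential ideal, $d\mathcal I\subseteq\mathcal I$; and the distribution $\Delta=\{V : \theta^A(V)=\theta_B(V)=0 \text{ for all } A,B\}$ is in involution on $U$. 3. The Pfaffian system is integrable: $N=D+L$ for a natural number $D$, and $\Sigma_P$ is an integral manifold of the maximal dimension $2N-2L=2D$, that is, an embedded submanifold of dimension $2D$ whose tangent space at each of its points is $\Delta$. Likewise, for every $z_0\in U$ the set $\{z\in U : \mathcal D_A(z)=\mathcal D_A(z_0)\text{ for all }A\}$ is a maximal integral manifold, of dimension $2D$. The restriction of $\omega$ to $\Delta$ is nondegenerate at every point of $U$, so $D$ is the number of physical degrees of freedom. For $L=2(N-M)$ first class constraints there are $4(N-M)$ constraints in total and $2D=2N-4(N-M)=4M-2N$. -/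

import Mathlib

open Set Manifold
open scoped ContDiff Topology

noncomputable section

namespace GaugeFixing

/-! ### Differential forms on a smooth manifold of dimension `m` -/

/-- The model space `ℝᵐ`. The tangent space `TangentSpace (𝓡 m) x` of a manifold modelled on it is,
by definition, a copy of `ℝᵐ` (identified with it by the preferred chart at `x`). -/
abbrev E (m : ℕ) : Type := EuclideanSpace ℝ (Fin m)

/-- Differential `n`-forms (not necessarily smooth) on an `m`-dimensional manifold `P`. -/
abbrev DForm (m : ℕ) (P : Type*) [TopologicalSpace P] [ChartedSpace (E m) P] (n : ℕ) : Type _ :=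
  ∀ x : P, (TangentSpace (𝓡 m) x) [⋀^Fin n]→L[ℝ] ℝ

/-- Covector fields (`1`-forms, written as fields of linear functionals). -/
abbrev CovectorField (m : ℕ) (P : Type*) [TopologicalSpace P] [ChartedSpace (E m) P] : Type _ :=
  ∀ x : P, TangentSpace (𝓡 m) x →L[ℝ] ℝ

section Forms

variable {m : ℕ} {P : Type*} [TopologicalSpace P] [ChartedSpace (E m) P]

/-- The coordinate expression `(e⁻¹)^* α` of a form in a chart `e`; meaningful on `e.target`. -/
def inChart (e : OpenPartialHomeomorph P (E m)) {n : ℕ} (α : DForm m P n) (y : E m) :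
    E m [⋀^Fin n]→L[ℝ] ℝ :=
  (α (e.symm y)).compContinuousLinearMap (mfderiv (𝓡 m) (𝓡 m) e.symm y)

/-- The form `α` is smooth on the open set `U`: its coordinate expressions are. -/
def SmoothFormOn {n : ℕ} (α : DForm m P n) (U : Set P) : Prop :=
  ∀ e ∈ atlas (E m) P, ContDiffOn ℝ ∞ (inChart e α) (e.target ∩ e.symm ⁻¹' U)

/-- The exterior derivative, computed at `x` in the preferred chart at `x`. -/
def extD {n : ℕ} (α : DForm m P n) : DForm m P (n + 1) := fun x =>
  (extDeriv (inChart (chartAt (E m) x) α) (chartAt (E m) x x)).compContinuousLinearMap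
    (mfderiv (𝓡 m) (𝓡 m) (chartAt (E m) x) x)

/-- The exterior product `θ ∧ β` of a linear functional and an alternating `n`-form:
`(θ ∧ β)(v₀, …, vₙ) = ∑ᵢ (-1)ⁱ θ(vᵢ) β(v₀, …, v̂ᵢ, …, vₙ)`. -/
def wedge {n : ℕ} (θ : E m →L[ℝ] ℝ) (β : E m [⋀^Fin n]→L[ℝ] ℝ) :
    E m [⋀^Fin (n + 1)]→L[ℝ] ℝ :=
  ContinuousAlternatingMap.alternatizeUncurryFin (θ.smulRight β)

/-- The differential `df` of a real function. -/
def dFun (f : P → ℝ) : CovectorField m P := fun x => mvfderiv (𝓡 m) f x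

/-! ### Pfaffian systems -/

variable {ι : Type*} [Fintype ι]

/-- The distribution `Δ = {V | θ^A(V) = 0 for all A}` of a Pfaffian system, at the point `x`. -/
def distribution (θ : ι → CovectorField m P) (x : P) : Submodule ℝ (TangentSpace (𝓡 m) x) :=
  ⨅ A, LinearMap.ker (θ A x).toLinearMap

/-- The Pfaffians are linearly independent at every point of `U`. -/
def PfaffiansIndependent (θ : ι → CovectorField m P) (U : Set P) : Prop :=
  ∀ x ∈ U, LinearIndependent ℝ (fun A => θ A x)

/-- The `n`-form `α` belongs, on `U`, to the ideal generated by the Pfaffians in the exterior algebra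
of smooth forms on `U`: `α = ∑_A θ^A ∧ β_A` with smooth forms `β_A` of degree `n - 1`
(the degree-zero part of the ideal is zero). -/
def MemIdeal (θ : ι → CovectorField m P) (U : Set P) : ∀ n : ℕ, DForm m P n → Prop
  | 0, α => ∀ x ∈ U, α x = 0
  | n + 1, α => ∃ β : ι → DForm m P n, (∀ A, SmoothFormOn (β A) U) ∧
      ∀ x ∈ U, α x = ∑ A, wedge (θ A x) (β A x)

/-- The ideal `I` generated by the Pfaffians on `U` is a differential ideal: `dI ⊆ I`. -/
def GeneratesDifferentialIdeal (θ : ι → CovectorField m P) (U : Set P) : Prop :=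
  ∀ (n : ℕ) (α : DForm m P n), MemIdeal θ U n α → MemIdeal θ U (n + 1) (extD α)

/-- A vector field is smooth on `V`. -/
def SmoothVectorFieldOn [IsManifold (𝓡 m) ∞ P] (X : ∀ x : P, TangentSpace (𝓡 m) x) (V : Set P) : Prop :=
  ContMDiffOn (𝓡 m) (𝓡 m).tangent ∞ (fun x => (⟨x, X x⟩ : TangentBundle (𝓡 m) P)) V

/-- The distribution is in involution on `U`: the Lie bracket of two smooth (local) vector fields
lying in `Δ` lies in `Δ`. -/
def Involutive [IsManifold (𝓡 m) ∞ P] (θ : ι → CovectorField m P) (U : Set P) : Prop :=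
  ∀ V : Set P, IsOpen V → V ⊆ U → ∀ X Y : ∀ x : P, TangentSpace (𝓡 m) x,
    SmoothVectorFieldOn X V → SmoothVectorFieldOn Y V →
    (∀ x ∈ V, X x ∈ distribution θ x) → (∀ x ∈ V, Y x ∈ distribution θ x) →
    ∀ x ∈ V, VectorField.mlieBracket (𝓡 m) X Y x ∈ distribution θ x

/-- `S ⊆ P` is a `k`-dimensional integral manifold of the Pfaffian system of maximal possible
dimension `k = m - #θ`: with the subspace topology it carries a smooth structure of dimension `k`
for which the inclusion `i` is a smooth embedding, and its tangent spaces are exactly the spaces of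
the distribution (in particular `i^*θ^A = 0`). -/
def IsMaximalIntegralManifold (θ : ι → CovectorField m P) (k : ℕ) (S : Set P) : Prop :=
  k + Fintype.card ι = m ∧
  ∃ _ : ChartedSpace (E k) S,
    IsManifold (𝓡 k) ∞ S ∧
    IsSmoothEmbedding (𝓡 k) (𝓡 m) ∞ (Subtype.val : S → P) ∧
    ∀ z : S, LinearMap.range
      (mfderiv (𝓡 k) (𝓡 m) (Subtype.val : S → P) z).toLinearMap = distribution θ (z : P)

end Forms

/-! ### Phase space and brackets -/

/-- A symplectic form: a smooth, closed, nondegenerate `2`-form. -/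
structure SymplecticForm (m : ℕ) (P : Type*) [TopologicalSpace P] [ChartedSpace (E m) P] where
  form : DForm m P 2
  smooth : SmoothFormOn form univ
  closed : ∀ x, extD form x = 0
  nondegenerate : ∀ (x : P) (v : TangentSpace (𝓡 m) x),
    (∀ w : TangentSpace (𝓡 m) x, form x ![v, w] = 0) → v = 0

section Brackets

variable {m : ℕ} {P : Type*} [TopologicalSpace P] [ChartedSpace (E m) P]

/-- The map `v ↦ Ω(v, ·)`. -/
def SymplecticForm.flat (Ω : SymplecticForm m P) (x : P) :
    TangentSpace (𝓡 m) x →ₗ[ℝ] Module.Dual ℝ (TangentSpace (𝓡 m) x) :=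
  have h0 : ∀ u v w : TangentSpace (𝓡 m) x, Function.update ![v, w] 0 u = ![u, w] := by
    intro u v w; ext1 i; fin_cases i <;> rfl
  have h1 : ∀ u v w : TangentSpace (𝓡 m) x, Function.update ![v, w] 1 u = ![v, u] := by
    intro u v w; ext1 i; fin_cases i <;> rfl
  LinearMap.mk₂ ℝ (fun v w => Ω.form x ![v, w])
    (fun v v' w => by
      have h := (Ω.form x).map_update_add ![v, w] 0 v v'
      rwa [h0, h0, h0] at h)
    (fun c v w => by
      have h := (Ω.form x).map_update_smul ![v, w] 0 c v
      rwa [h0, h0] at h)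
    (fun v w w' => by
      have h := (Ω.form x).map_update_add ![v, w] 1 w w'
      rwa [h1, h1, h1] at h)
    (fun c v w => by
      have h := (Ω.form x).map_update_smul ![v, w] 1 c w
      rwa [h1, h1] at h)

instance (x : P) : FiniteDimensional ℝ (TangentSpace (𝓡 m) x) :=
  inferInstanceAs (FiniteDimensional ℝ (E m))

theorem SymplecticForm.flat_injective (Ω : SymplecticForm m P) (x : P) :
    Function.Injective (Ω.flat x) := by
  rw [← LinearMap.ker_eq_bot, LinearMap.ker_eq_bot']
  intro v hv
  exact Ω.nondegenerate x v fun w => by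
    have := LinearMap.congr_fun hv w
    simpa [SymplecticForm.flat] using this

/-- The isomorphism `v ↦ Ω(v, ·)` between tangent and cotangent space. -/
def SymplecticForm.flatEquiv (Ω : SymplecticForm m P) (x : P) :
    TangentSpace (𝓡 m) x ≃ₗ[ℝ] Module.Dual ℝ (TangentSpace (𝓡 m) x) :=
  LinearEquiv.ofInjectiveOfFinrankEq (Ω.flat x) (Ω.flat_injective x)
    (Subspace.dual_finrank_eq).symm

/-- The Hamiltonian vector field `V_G` of `G`, determined by `dG = Ω(V_G, ·)`. -/
def hamiltonianVector (Ω : SymplecticForm m P) (G : P → ℝ) (x : P) : TangentSpace (𝓡 m) x :=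
  (Ω.flatEquiv x).symm (dFun G x).toLinearMap

theorem hamiltonianVector_spec (Ω : SymplecticForm m P) (G : P → ℝ) (x : P)
    (w : TangentSpace (𝓡 m) x) : Ω.form x ![hamiltonianVector Ω G x, w] = dFun G x w := by
  have h := (Ω.flatEquiv x).apply_symm_apply (dFun G x).toLinearMap
  exact LinearMap.congr_fun h w

/-- The Poisson bracket `{G, F} = V_G(F)`; for `Ω = ∑ dp_a ∧ dq^a` it is
`∑ ∂G/∂q^a ∂F/∂p_a - ∂G/∂p_a ∂F/∂q^a`. -/
def poisson (Ω : SymplecticForm m P) (G F : P → ℝ) (x : P) : ℝ :=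
  dFun F x (hamiltonianVector Ω G x)

/-- The constraint commutation matrix `D_{AB} = {D_A, D_B}` of a family of functions. -/
def commutationMatrix {ι : Type*} (Ω : SymplecticForm m P) (Φ : ι → P → ℝ) (x : P) :
    Matrix ι ι ℝ :=
  Matrix.of fun A B => poisson Ω (Φ A) (Φ B) x

/-- The Dirac bracket `{F, G}_D = {F, G} - {F, D_A} D^{AB} {D_B, G}` of a family of constraints
with invertible commutation matrix. -/
def diracBracket {ι : Type*} [Fintype ι] [DecidableEq ι] (Ω : SymplecticForm m P)
    (Φ : ι → P → ℝ) (F G : P → ℝ) (x : P) : ℝ :=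
  poisson Ω F G x -
    ∑ A, ∑ B, poisson Ω F (Φ A) x * (commutationMatrix Ω Φ x)⁻¹ A B * poisson Ω (Φ B) G x

end Brackets

/-! ### Gauge theories in Hamiltonian form and their gauge fixings -/

/-- The (finite-dimensional) Hamiltonian formulation of a gauge theory on a `2N`-dimensional phase
space `P` with `L` irreducible first class constraints `C^A ≈ 0`. -/
structure HamiltonianGaugeTheory (N L : ℕ) (P : Type*) [TopologicalSpace P]
    [ChartedSpace (E (2 * N)) P] where
  /-- the symplectic form of phase space -/
  Ω : SymplecticForm (2 * N) P
  /-- the first class Hamiltonian -/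
  H : P → ℝ
  /-- the first class constraints, generating the gauge transformations -/
  C : Fin L → P → ℝ
  smooth_H : ContMDiff (𝓡 (2 * N)) 𝓘(ℝ, ℝ) ∞ H
  smooth_C : ∀ A, ContMDiff (𝓡 (2 * N)) 𝓘(ℝ, ℝ) ∞ (C A)
  /-- the constraints are independent on the first class constraint manifold -/
  irreducible : ∀ z, (∀ A, C A z = 0) → LinearIndependent ℝ (fun A => dFun (m := 2 * N) (C A) z)
  /-- `{C_A, C_B} ≈ 0` -/
  first_class : ∀ z, (∀ A, C A z = 0) → ∀ A B, poisson Ω (C A) (C B) z = 0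
  /-- `{C_A, H} ≈ 0` -/
  consistent : ∀ z, (∀ A, C A z = 0) → ∀ A, poisson Ω (C A) H z = 0

variable {N L : ℕ} {P : Type*} [TopologicalSpace P] [ChartedSpace (E (2 * N)) P]

/-- A complete gauge fixing through the Dirac bracket: one further constraint `S_B` for each first
class constraint, such that the commutation matrix of all `2L` constraints `C^A, S_B` is invertible
throughout the open region `U`. This is the condition for their Dirac bracket to exist on `U`; it
says equivalently that the multipliers `Λ^A` of the constraints in the extended Hamiltonian are
uniquely determined by the preservation of all constraints. -/
structure CompleteGaugeFixing (T : HamiltonianGaugeTheory N L P) where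
  /-- the region of phase space on which the gauge is fixed -/
  U : Set P
  isOpen_U : IsOpen U
  /-- the gauge fixing constraints -/
  S : Fin L → P → ℝ
  smooth_S : ∀ B, ContMDiffOn (𝓡 (2 * N)) 𝓘(ℝ, ℝ) ∞ (S B) U
  invertible : ∀ z ∈ U, IsUnit (commutationMatrix T.Ω (Sum.elim T.C S) z)

namespace CompleteGaugeFixing

variable {T : HamiltonianGaugeTheory N L P} (G : CompleteGaugeFixing T)

/-- All constraints `D = {C^1, …, C^L, S_1, …, S_L}`. -/
def constraints : Fin L ⊕ Fin L → P → ℝ := Sum.elim T.C G.S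

/-- The Pfaffians `θ^A = dC^A`, `θ_B = dS_B`. -/
def pfaffians : Fin L ⊕ Fin L → CovectorField (2 * N) P := fun A => dFun (G.constraints A)

/-- The submanifold of `U` on which the constraints take the same values as at `z₀`. -/
def leaf (z₀ : P) : Set P := {z ∈ G.U | ∀ A, G.constraints A z = G.constraints A z₀}

/-- The physical phase space `Σ_P`: the points of `U` at which all constraints vanish. -/
def physicalPhaseSpace : Set P := {z ∈ G.U | ∀ A, G.constraints A z = 0}

end CompleteGaugeFixing

end GaugeFixing

end

set_option maxSynthPendingDepth 3

noncomputable section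

/-! Everything follows from two facts: the matrix `D_{AB}` is invertible at each point of `U`, and
the Pfaffians are exact.

Invertibility is linear algebra at a point. A relation among the differentials, evaluated on the
Hamiltonian vectors `V_B`, is annihilated by `D`, so the differentials are independent
(`linearIndependent_dFun`). The symplectic complement of `Δ` is spanned by the `V_A`, and a
combination of them lying in `Δ` has coefficients annihilated by `D`; hence `Δ` meets its complement
trivially and `Ω` is nondegenerate on it (`eq_zero_of_mem_distribution`). The Dirac bracket kills
constraints because `D⁻¹D = 1`.

Exactness gives the differential statements without a general Frobenius theorem: `d(df ∧ β) = -df ∧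
dβ` keeps the ideal closed under `d` (`generatesDifferentialIdeal_dFun`), and symmetry of second
derivatives gives involution (`involutive_dFun`). The integral manifolds are the common level sets
of the constraints: the inverse function theorem straightens them to linear slices, and the slice
charts supply the embedded smooth structure (`isMaximalIntegralManifold_levelSet`). -/

namespace GaugeFixing

/-! ### Exterior calculus on the model space -/

section FlatForms

variable {m n : ℕ}

theorem wedge_apply (θ : E m →L[ℝ] ℝ) (β : E m [⋀^Fin n]→L[ℝ] ℝ) (v : Fin (n + 1) → E m) :
    wedge θ β v = ∑ i : Fin (n + 1), (-1) ^ (i : ℕ) • (θ (v i) • β (i.removeNth v)) :=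
  ContinuousAlternatingMap.alternatizeUncurryFin_apply _ v

theorem wedge_compContinuousLinearMap (θ : E m →L[ℝ] ℝ) (β : E m [⋀^Fin n]→L[ℝ] ℝ)
    (g : E m →L[ℝ] E m) :
    (wedge θ β).compContinuousLinearMap g = wedge (θ ∘L g) (β.compContinuousLinearMap g) := by
  ext v
  simp only [ContinuousAlternatingMap.compContinuousLinearMap_apply, wedge_apply]
  rfl

theorem wedge_neg (θ : E m →L[ℝ] ℝ) (β : E m [⋀^Fin n]→L[ℝ] ℝ) : wedge θ (-β) = -wedge θ β := by
  ext v
  simp [wedge_apply]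

theorem wedge_zero (θ : E m →L[ℝ] ℝ) : wedge θ (0 : E m [⋀^Fin n]→L[ℝ] ℝ) = 0 := by
  ext v
  simp [wedge_apply]

/-- Exhibits the product as a continuous bilinear map followed by a continuous linear one, which
makes it differentiable. -/
theorem wedge_eq_smulRightL (θ : E m →L[ℝ] ℝ) (β : E m [⋀^Fin n]→L[ℝ] ℝ) :
    wedge θ β = ContinuousAlternatingMap.alternatizeUncurryFinCLM ℝ (E m) ℝ
      (ContinuousLinearMap.smulRightL ℝ (E m) (E m [⋀^Fin n]→L[ℝ] ℝ) θ β) := rfl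

theorem differentiableAt_wedge {θ : E m → E m →L[ℝ] ℝ} {β : E m → E m [⋀^Fin n]→L[ℝ] ℝ} {x : E m}
    (hθ : DifferentiableAt ℝ θ x) (hβ : DifferentiableAt ℝ β x) :
    DifferentiableAt ℝ (fun y => wedge (θ y) (β y)) x := by
  simp only [wedge_eq_smulRightL]
  fun_prop

open ContinuousAlternatingMap in
/-- `d(df ∧ β) = -df ∧ dβ` on a normed space. -/
theorem extDeriv_alternatizeUncurryFin_smulRight_fderiv {V : Type*} [NormedAddCommGroup V]
    [NormedSpace ℝ V] {f : V → ℝ} {β : V → V [⋀^Fin n]→L[ℝ] ℝ} {x : V}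
    (hf : ContDiffAt ℝ ∞ f x) (hβ : DifferentiableAt ℝ β x) :
    extDeriv (fun y => alternatizeUncurryFin ((fderiv ℝ f y).smulRight (β y))) x =
      -alternatizeUncurryFin ((fderiv ℝ f x).smulRight (extDeriv β x)) := by
  have hd : DifferentiableAt ℝ (fderiv ℝ f) x :=
    (hf.fderiv_right (m := 1) (by norm_cast)).differentiableAt (by norm_num)
  have hsymm : IsSymmSndFDerivAt ℝ f x :=
    hf.isSymmSndFDerivAt (by simp only [minSmoothness_of_isRCLikeNormedField]; norm_cast)
  let B := ContinuousLinearMap.smulRightL ℝ V (V [⋀^Fin n]→L[ℝ] ℝ)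
  -- The two terms of the product rule: `f₁` differentiates `df`, `f₂` differentiates `β`.
  let f₁ : V →L[ℝ] V →L[ℝ] V [⋀^Fin n]→L[ℝ] ℝ := (B.flip (β x)) ∘L fderiv ℝ (fderiv ℝ f) x
  let f₂ : V →L[ℝ] V →L[ℝ] V [⋀^Fin n]→L[ℝ] ℝ := (B (fderiv ℝ f x)) ∘L fderiv ℝ β x
  have hder : fderiv ℝ (fun y => alternatizeUncurryFin ((fderiv ℝ f y).smulRight (β y))) x =
      alternatizeUncurryFinCLM ℝ V ℝ ∘L (f₁ + f₂) := by
    have h1 : HasFDerivAt (fun y => B (fderiv ℝ f y) (β y)) (f₁ + f₂) x := by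
      refine ((B.hasFDerivAt.comp x hd.hasFDerivAt).clm_apply hβ.hasFDerivAt).congr_fderiv ?_
      ext h k v
      simp [f₁, f₂, add_comm]
    exact ((alternatizeUncurryFinCLM ℝ V ℝ).hasFDerivAt.comp x h1).fderiv
  -- Antisymmetrising the symmetric second derivative of `f` gives `0`; this is `d(df) = 0`.
  have e1 : alternatizeUncurryFin (alternatizeUncurryFinCLM ℝ V ℝ ∘L f₁) = 0 :=
    alternatizeUncurryFin_alternatizeUncurryFinCLM_comp_of_symmetric fun u v => by
      ext w
      simp [f₁, B, hsymm u v]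
  -- The same vanishing for `f₂ + f₂.flip` replaces `f₂` by `-f₂.flip`. The flip is `df ⊗ dβ` after
  -- antisymmetrisation in the inner slots, which is where the minus sign comes from.
  have e2 : alternatizeUncurryFin (alternatizeUncurryFinCLM ℝ V ℝ ∘L (f₂ + f₂.flip)) = 0 :=
    alternatizeUncurryFin_alternatizeUncurryFinCLM_comp_of_symmetric fun u v => by
      simp [add_comm]
  have e3 : alternatizeUncurryFinCLM ℝ V ℝ ∘L f₂.flip =
      (fderiv ℝ f x).smulRight (extDeriv β x) := by
    ext1 h
    have : f₂.flip h = (fderiv ℝ f x h) • fderiv ℝ β x := by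
      ext k v
      simp [f₂, B]
    simp [this, extDeriv]
  rw [ContinuousLinearMap.comp_add, alternatizeUncurryFin_add, e3] at e2
  rw [extDeriv, hder, ContinuousLinearMap.comp_add, alternatizeUncurryFin_add, e1, zero_add]
  exact eq_neg_of_add_eq_zero_left e2

/-- `d(df ∧ β) = -df ∧ dβ` on the model space. -/
theorem extDeriv_wedge_fderiv {f : E m → ℝ} {β : E m → E m [⋀^Fin n]→L[ℝ] ℝ} {x : E m}
    (hf : ContDiffAt ℝ ∞ f x) (hβ : DifferentiableAt ℝ β x) :
    extDeriv (fun y => wedge (fderiv ℝ f y) (β y)) x = -wedge (fderiv ℝ f x) (extDeriv β x) :=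
  extDeriv_alternatizeUncurryFin_smulRight_fderiv hf hβ

theorem extDeriv_fun_sum {ι : Type*} (s : Finset ι) {α : ι → E m → E m [⋀^Fin n]→L[ℝ] ℝ} {x : E m}
    (h : ∀ i ∈ s, DifferentiableAt ℝ (α i) x) :
    extDeriv (fun y => ∑ i ∈ s, α i y) x = ∑ i ∈ s, extDeriv (α i) x := by
  simp only [extDeriv, ← ContinuousAlternatingMap.alternatizeUncurryFinCLM_apply]
  rw [fderiv_fun_sum h, map_sum]

theorem contDiffOn_extDeriv {α : E m → E m [⋀^Fin n]→L[ℝ] ℝ} {s : Set (E m)} (hs : IsOpen s)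
    (h : ContDiffOn ℝ ∞ α s) : ContDiffOn ℝ ∞ (extDeriv α) s :=
  (ContinuousAlternatingMap.alternatizeUncurryFinCLM ℝ (E m) ℝ).contDiff.comp_contDiffOn
    (h.fderiv_of_isOpen hs (by simp))

end FlatForms

/-! ### Forms in charts, and the ideal generated by exact Pfaffians -/

section Forms

variable {m : ℕ} {P : Type*} [TopologicalSpace P] [ChartedSpace (E m) P]

omit [ChartedSpace (E m) P] in
theorem isOpen_chart_preimage (e : OpenPartialHomeomorph P (E m)) {U : Set P} (hU : IsOpen U) :
    IsOpen (e.target ∩ e.symm ⁻¹' U) :=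
  e.symm.isOpen_inter_preimage hU

variable [IsManifold (𝓡 m) ∞ P] {e c : OpenPartialHomeomorph P (E m)}

theorem mdifferentiableAt_of_mem_atlas (he : e ∈ atlas (E m) P) {x : P} (hx : x ∈ e.source) :
    MDifferentiableAt (𝓡 m) (𝓡 m) e x := by
  have : IsManifold (𝓡 m) 1 P := .of_le (n := ∞) (by norm_cast)
  exact mdifferentiableAt_atlas he hx

theorem mdifferentiableAt_symm_of_mem_atlas (he : e ∈ atlas (E m) P) {y : E m}
    (hy : y ∈ e.target) : MDifferentiableAt (𝓡 m) (𝓡 m) e.symm y := by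
  have : IsManifold (𝓡 m) 1 P := .of_le (n := ∞) (by norm_cast)
  exact mdifferentiableAt_atlas_symm he hy

/-- The derivative of the inverse of a chart, as a linear map between vector spaces. -/
def symmDeriv (e : OpenPartialHomeomorph P (E m)) (y : E m) : E m →L[ℝ] E m :=
  mfderiv (𝓡 m) (𝓡 m) e.symm y

/-- The derivative of a chart, as a linear map between vector spaces. -/
def chartDeriv (e : OpenPartialHomeomorph P (E m)) (x : P) : E m →L[ℝ] E m :=
  mfderiv (𝓡 m) (𝓡 m) e x

/-- The differential of a function, as a linear functional on the model space. -/
def modelDFun (f : P → ℝ) (x : P) : E m →L[ℝ] ℝ := dFun (m := m) f x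

/-- The value of a form, as an alternating map on the model space. -/
def modelForm {n : ℕ} (α : DForm m P n) (x : P) : E m [⋀^Fin n]→L[ℝ] ℝ := α x

omit [IsManifold (𝓡 m) ∞ P] in
theorem inChart_def (e : OpenPartialHomeomorph P (E m)) {n : ℕ} (α : DForm m P n) (y : E m) :
    inChart e α y = (modelForm α (e.symm y)).compContinuousLinearMap (symmDeriv e y) := rfl

theorem symmDeriv_eq (he : e ∈ atlas (E m) P) (hc : c ∈ atlas (E m) P) {y : E m}
    (hy : y ∈ e.target) (hyc : e.symm y ∈ c.source) :
    symmDeriv e y = symmDeriv c (c (e.symm y)) ∘L fderiv ℝ (c ∘ e.symm) y := by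
  have h1 : MDifferentiableAt (𝓡 m) (𝓡 m) (c ∘ e.symm) y :=
    (mdifferentiableAt_of_mem_atlas hc hyc).comp y (mdifferentiableAt_symm_of_mem_atlas he hy)
  have h2 : MDifferentiableAt (𝓡 m) (𝓡 m) c.symm ((c ∘ e.symm) y) :=
    mdifferentiableAt_symm_of_mem_atlas hc (c.map_source hyc)
  have h3 : c.symm ∘ (c ∘ e.symm) =ᶠ[𝓝 y] e.symm := by
    filter_upwards [(isOpen_chart_preimage e c.open_source).mem_nhds ⟨hy, hyc⟩] with z hz
    exact c.left_inv hz.2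
  have h4 := mfderiv_comp y h2 h1
  rw [h3.mfderiv_eq, mfderiv_eq_fderiv] at h4
  exact h4

theorem mfderiv_chart_comp_symmDeriv (he : e ∈ atlas (E m) P) (hc : c ∈ atlas (E m) P) {y : E m}
    (hy : y ∈ e.target) (hyc : e.symm y ∈ c.source) :
    chartDeriv c (e.symm y) ∘L symmDeriv e y =
      fderiv ℝ (c ∘ e.symm) y := by
  have h4 := mfderiv_comp y (mdifferentiableAt_of_mem_atlas hc hyc)
    (mdifferentiableAt_symm_of_mem_atlas he hy)
  rw [mfderiv_eq_fderiv] at h4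
  exact h4.symm

theorem dFun_comp_symmDeriv (he : e ∈ atlas (E m) P) {f : P → ℝ} {y : E m} (hy : y ∈ e.target)
    (hf : MDifferentiableAt (𝓡 m) 𝓘(ℝ, ℝ) f (e.symm y)) :
    modelDFun f (e.symm y) ∘L symmDeriv e y = fderiv ℝ (f ∘ e.symm) y := by
  have h4 := mfderiv_comp y hf (mdifferentiableAt_symm_of_mem_atlas he hy)
  rw [mfderiv_eq_fderiv] at h4
  exact h4.symm

theorem fderiv_comp_symm_comp_mfderiv (he : e ∈ atlas (E m) P) {f : P → ℝ} {x : P}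
    (hx : x ∈ e.source) (hf : MDifferentiableAt (𝓡 m) 𝓘(ℝ, ℝ) f x) :
    fderiv ℝ (f ∘ e.symm) (e x) ∘L chartDeriv e x =
      modelDFun f x := by
  have h1 : MDifferentiableAt (𝓡 m) 𝓘(ℝ, ℝ) (f ∘ e.symm) (e x) :=
    MDifferentiableAt.comp (e x) (by rwa [e.left_inv hx])
      (mdifferentiableAt_symm_of_mem_atlas he (e.map_source hx))
  have h2 : (f ∘ e.symm) ∘ e =ᶠ[𝓝 x] f := by
    filter_upwards [e.open_source.mem_nhds hx] with z hz
    exact congrArg f (e.left_inv hz)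
  have h3 := mfderiv_comp x h1 (mdifferentiableAt_of_mem_atlas he hx)
  rw [h2.mfderiv_eq, mfderiv_eq_fderiv] at h3
  exact h3.symm

theorem contDiffAt_transition (he : e ∈ atlas (E m) P) (hc : c ∈ atlas (E m) P) {y : E m}
    (hy : y ∈ e.target) (hyc : e.symm y ∈ c.source) : ContDiffAt ℝ ∞ (c ∘ e.symm) y := by
  have h1 := contMDiffAt_of_mem_maximalAtlas
    (IsManifold.subset_maximalAtlas (I := 𝓡 m) (n := ∞) hc) hyc
  have h2 := contMDiffAt_symm_of_mem_maximalAtlas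
    (IsManifold.subset_maximalAtlas (I := 𝓡 m) (n := ∞) he) hy
  exact (h1.comp y h2).contDiffAt

theorem contDiffAt_comp_symm (he : e ∈ atlas (E m) P) {F : Type*} [NormedAddCommGroup F]
    [NormedSpace ℝ F] {f : P → F} {y : E m} (hy : y ∈ e.target)
    (hf : ContMDiffAt (𝓡 m) 𝓘(ℝ, F) ∞ f (e.symm y)) : ContDiffAt ℝ ∞ (f ∘ e.symm) y :=
  (hf.comp y (contMDiffAt_symm_of_mem_maximalAtlas
    (IsManifold.subset_maximalAtlas (I := 𝓡 m) (n := ∞) he) hy)).contDiffAt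

omit [IsManifold (𝓡 m) ∞ P] in
theorem SmoothFormOn.contDiffAt {n : ℕ} {α : DForm m P n} {U : Set P} (h : SmoothFormOn α U)
    (hU : IsOpen U) (he : e ∈ atlas (E m) P) {y : E m} (hy : y ∈ e.target) (hyU : e.symm y ∈ U) :
    ContDiffAt ℝ ∞ (inChart e α) y :=
  (h e he).contDiffAt ((isOpen_chart_preimage e hU).mem_nhds ⟨hy, hyU⟩)

/-- The exterior derivative may be computed in any chart. -/
theorem inChart_extD {n : ℕ} {β : DForm m P n} {U : Set P} (hβ : SmoothFormOn β U)
    (hU : IsOpen U) (he : e ∈ atlas (E m) P) {y : E m} (hy : y ∈ e.target) (hyU : e.symm y ∈ U) :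
    inChart e (extD β) y = extDeriv (inChart e β) y := by
  set c := chartAt (E m) (e.symm y)
  have hc : c ∈ atlas (E m) P := chart_mem_atlas _ _
  have hyc : e.symm y ∈ c.source := mem_chart_source _ _
  -- Near `y` the two coordinate expressions differ by pullback along the transition map, and
  -- `extDeriv` commutes with pullback.
  have h1 : inChart e β =ᶠ[𝓝 y] fun z =>
      (inChart c β ((c ∘ e.symm) z)).compContinuousLinearMap (fderiv ℝ (c ∘ e.symm) z) := by
    filter_upwards [(isOpen_chart_preimage e c.open_source).mem_nhds ⟨hy, hyc⟩] with z hz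
    rw [inChart_def, inChart_def, symmDeriv_eq he hc hz.1 hz.2]
    have : c.symm ((c ∘ e.symm) z) = e.symm z := c.left_inv hz.2
    rw [this]
    rfl
  have hd : DifferentiableAt ℝ (inChart c β) ((c ∘ e.symm) y) :=
    (hβ.contDiffAt hU hc (c.map_source hyc) (by rwa [c.left_inv hyc])).differentiableAt (by simp)
  rw [h1.extDeriv_eq, extDeriv_pullback hd (contDiffAt_transition he hc hy hyc)
    (by simp only [minSmoothness_of_isRCLikeNormedField]; norm_cast), ← mfderiv_chart_comp_symmDeriv he hc hy hyc]
  rfl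

/-- `extD` uses a chart that varies with the point; chart independence replaces it by one fixed
chart, where smoothness is visible. -/
theorem SmoothFormOn.extD {n : ℕ} {β : DForm m P n} {U : Set P} (hβ : SmoothFormOn β U)
    (hU : IsOpen U) : SmoothFormOn (extD β) U := fun e he =>
  (contDiffOn_extDeriv (isOpen_chart_preimage e hU) (hβ e he)).congr fun _ hy =>
    inChart_extD hβ hU he hy.1 hy.2

omit [IsManifold (𝓡 m) ∞ P] in
theorem SmoothFormOn.neg {n : ℕ} {β : DForm m P n} {U : Set P} (hβ : SmoothFormOn β U) :
    SmoothFormOn (fun x => -β x) U := fun e he => (hβ e he).neg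

omit [IsManifold (𝓡 m) ∞ P] in
theorem extD_eq_of_inChart {n : ℕ} {α : DForm m P n} {x : P} {η : E m [⋀^Fin (n + 1)]→L[ℝ] ℝ}
    (h : extDeriv (inChart (chartAt (E m) x) α) (chartAt (E m) x x) = η) :
    extD α x = η.compContinuousLinearMap
      (chartDeriv (chartAt (E m) x) x) := by
  subst h; rfl

variable {ι : Type*} [Fintype ι]

/-- Exact Pfaffians generate a differential ideal. -/
theorem generatesDifferentialIdeal_dFun {f : ι → P → ℝ} {U : Set P} (hU : IsOpen U)
    (hf : ∀ A, ContMDiffOn (𝓡 m) 𝓘(ℝ, ℝ) ∞ (f A) U) :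
    GeneratesDifferentialIdeal (fun A => dFun (m := m) (f A)) U := by
  intro n α hα
  cases n with
  | zero =>
    -- The degree-zero part of the ideal is zero on the open set `U`, so the derivative vanishes
    -- there too.
    refine ⟨fun _ _ => 0, fun _ e _ => contDiffOn_const (c := 0), fun x hx => ?_⟩
    have h0 : inChart (chartAt (E m) x) α =ᶠ[𝓝 (chartAt (E m) x x)] fun _ => 0 := by
      filter_upwards [(isOpen_chart_preimage (chartAt (E m) x) hU).mem_nhds
        ⟨mem_chart_target _ _, by simpa using hx⟩] with y hy
      rw [inChart_def]
      have : modelForm α ((chartAt (E m) x).symm y) = 0 := hα _ hy.2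
      rw [this]
      rfl
    have h1 : extDeriv (inChart (chartAt (E m) x) α) (chartAt (E m) x x) = 0 := by
      rw [h0.extDeriv_eq, extDeriv, fderiv_const_apply]
      exact map_zero (ContinuousAlternatingMap.alternatizeUncurryFinCLM ℝ (E m) ℝ)
    rw [extD_eq_of_inChart h1]
    change _ = ∑ A, wedge (modelDFun (f A) x) 0
    simp only [wedge_zero, Finset.sum_const_zero]
    rfl
  | succ n =>
    obtain ⟨β, hβ, hαβ⟩ := hα
    -- The coefficients are those of `d(∑ df_A ∧ β_A) = ∑ df_A ∧ (-dβ_A)`.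
    refine ⟨fun A x => -extD (β A) x, fun A => ((hβ A).extD hU).neg, fun x hx => ?_⟩
    set c := chartAt (E m) x
    have hc : c ∈ atlas (E m) P := chart_mem_atlas _ _
    have hxc : x ∈ c.source := mem_chart_source _ _
    have hcx : c.symm (c x) = x := c.left_inv hxc
    have hfU : ∀ A, ∀ z ∈ U, ContMDiffAt (𝓡 m) 𝓘(ℝ, ℝ) ∞ (f A) z := fun A z hz =>
      (hf A).contMDiffAt (hU.mem_nhds hz)
    have h1 : inChart c α =ᶠ[𝓝 (c x)] fun y =>
        ∑ A, wedge (fderiv ℝ (f A ∘ c.symm) y) (inChart c (β A) y) := by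
      filter_upwards [(isOpen_chart_preimage c hU).mem_nhds
        ⟨c.map_source hxc, by simpa [hcx] using hx⟩] with y hy
      have h0 : modelForm α (c.symm y) = ∑ A, wedge (modelDFun (f A) (c.symm y))
          (modelForm (β A) (c.symm y)) := hαβ _ hy.2
      rw [inChart_def, h0]
      have : ∀ A, wedge (fderiv ℝ (f A ∘ c.symm) y) (inChart c (β A) y) =
          (wedge (modelDFun (f A) (c.symm y)) (modelForm (β A) (c.symm y))).compContinuousLinearMap
            (symmDeriv c y) := fun A => by
        rw [wedge_compContinuousLinearMap, inChart_def,
          ← dFun_comp_symmDeriv hc hy.1 ((hfU A _ hy.2).mdifferentiableAt (by simp))]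
      simp only [this]
      ext v
      simp [ContinuousAlternatingMap.sum_apply]
    have hsm : ∀ A, ContDiffAt ℝ ∞ (f A ∘ c.symm) (c x) := fun A =>
      contDiffAt_comp_symm hc (c.map_source hxc) (hfU A _ (by rwa [hcx]))
    have hdβ : ∀ A, DifferentiableAt ℝ (inChart c (β A)) (c x) := fun A =>
      ((hβ A).contDiffAt hU hc (c.map_source hxc) (by rwa [hcx])).differentiableAt (by simp)
    have h2 : extDeriv (inChart c α) (c x) = ∑ A, -wedge (fderiv ℝ (f A ∘ c.symm) (c x))
        (extDeriv (inChart c (β A)) (c x)) := by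
      rw [h1.extDeriv_eq, extDeriv_fun_sum]
      · exact Finset.sum_congr rfl fun A _ => extDeriv_wedge_fderiv (hsm A) (hdβ A)
      · exact fun A _ => differentiableAt_wedge
          (((hsm A).fderiv_right (m := 1) (by norm_cast)).differentiableAt (by norm_num)) (hdβ A)
    rw [extD_eq_of_inChart h2]
    have h3 : ∀ A, (wedge (fderiv ℝ (f A ∘ c.symm) (c x))
        (extDeriv (inChart c (β A)) (c x))).compContinuousLinearMap
          (chartDeriv c x) =
        wedge (modelDFun (f A) x) (modelForm (extD (β A)) x) := fun A => by
      rw [wedge_compContinuousLinearMap, fderiv_comp_symm_comp_mfderiv hc hxc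
        ((hfU A x hx).mdifferentiableAt (by simp))]
      rfl
    change _ = ∑ A, wedge (modelDFun (f A) x) (-modelForm (extD (β A)) x)
    simp only [wedge_neg, ← h3]
    ext v
    simp [ContinuousAlternatingMap.sum_apply]
    rfl

end Forms

theorem mem_distribution {m : ℕ} {P : Type*} [TopologicalSpace P] [ChartedSpace (E m) P]
    {ι : Type*} {θ : ι → CovectorField m P} {x : P} {v : TangentSpace (𝓡 m) x} :
    v ∈ distribution θ x ↔ ∀ A, θ A x v = 0 := by
  simp [distribution]

/-! ### Involutivity of the distribution of exact Pfaffians -/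

section Involution

/-- If `df` annihilates two vector fields, it annihilates their Lie bracket. -/
theorem fderiv_lieBracket_eq_zero {V : Type*} [NormedAddCommGroup V] [NormedSpace ℝ V]
    {f : V → ℝ} {X Y : V → V} {x : V} (hf : ContDiffAt ℝ ∞ f x)
    (hX : DifferentiableAt ℝ X x) (hY : DifferentiableAt ℝ Y x)
    (h0X : ∀ᶠ y in 𝓝 x, fderiv ℝ f y (X y) = 0) (h0Y : ∀ᶠ y in 𝓝 x, fderiv ℝ f y (Y y) = 0) :
    fderiv ℝ f x (VectorField.lieBracket ℝ X Y x) = 0 := by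
  have hd : DifferentiableAt ℝ (fderiv ℝ f) x :=
    (hf.fderiv_right (m := 1) (by norm_cast)).differentiableAt (by norm_num)
  have hsymm : IsSymmSndFDerivAt ℝ f x :=
    hf.isSymmSndFDerivAt (by simp only [minSmoothness_of_isRCLikeNormedField]; norm_cast)
  -- Differentiating `df(Z) = 0` in direction `v` trades `df(DZ v)` for a second derivative of `f`.
  -- In the bracket the two resulting terms cancel by symmetry.
  have key : ∀ {Z : V → V}, DifferentiableAt ℝ Z x → (∀ᶠ y in 𝓝 x, fderiv ℝ f y (Z y) = 0) →
      ∀ v, fderiv ℝ f x (fderiv ℝ Z x v) = -fderiv ℝ (fderiv ℝ f) x v (Z x) := by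
    intro Z hZ h0 v
    have h1 := (hd.hasFDerivAt.clm_apply hZ.hasFDerivAt).fderiv
    have h2 : (fun y => fderiv ℝ f y (Z y)) =ᶠ[𝓝 x] fun _ => 0 := h0
    rw [h2.fderiv_eq, fderiv_const_apply] at h1
    have h3 := DFunLike.congr_fun h1 v
    simp only [zero_apply, add_apply, ContinuousLinearMap.comp_apply,
      ContinuousLinearMap.flip_apply] at h3
    linarith
  rw [VectorField.lieBracket, map_sub, key hY h0Y, key hX h0X, hsymm (X x) (Y x)]
  ring

variable {m : ℕ} {P : Type*} [TopologicalSpace P] [ChartedSpace (E m) P] [IsManifold (𝓡 m) ∞ P]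

/-- The coordinate expression of a vector field in the preferred chart at `x`. -/
def chartField (x : P) (X : ∀ x : P, TangentSpace (𝓡 m) x) : E m → E m :=
  VectorField.mpullbackWithin 𝓘(ℝ, E m) (𝓡 m) (extChartAt (𝓡 m) x).symm X (range (𝓡 m))

theorem differentiableAt_chartField {x : P} {X : ∀ x : P, TangentSpace (𝓡 m) x} {V : Set P}
    (hV : IsOpen V) (hx : x ∈ V) (hX : SmoothVectorFieldOn X V) :
    DifferentiableAt ℝ (chartField x X) (chartAt (E m) x x) := by
  have : IsManifold (𝓡 m) 2 P := .of_le (n := ∞) (by norm_cast)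
  have h1 := ((hX.contMDiffAt (hV.mem_nhds hx)).mdifferentiableAt (by simp))
  rw [← mdifferentiableWithinAt_univ] at h1
  have h2 : DifferentiableWithinAt ℝ (chartField x X)
      ((extChartAt (𝓡 m) x).symm ⁻¹' univ ∩ range (𝓡 m)) (chartAt (E m) x x) :=
    h1.differentiableWithinAt_mpullbackWithin_vectorField
  rwa [preimage_univ, univ_inter, ModelWithCorners.range_eq_univ,
    differentiableWithinAt_univ] at h2

/-- `chartField` applies the inverse of the derivative of the inverse chart, so it cancels against
the factor that the chain rule contributes to `f ∘ e.symm`. -/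
theorem fderiv_comp_symm_chartField {x : P} {X : ∀ x : P, TangentSpace (𝓡 m) x} {f : P → ℝ}
    {y : E m} (hy : y ∈ (chartAt (E m) x).target)
    (hf : MDifferentiableAt (𝓡 m) 𝓘(ℝ, ℝ) f ((chartAt (E m) x).symm y)) :
    fderiv ℝ (f ∘ (chartAt (E m) x).symm) y (chartField x X y) =
      dFun f ((chartAt (E m) x).symm y) (X ((chartAt (E m) x).symm y)) := by
  have : IsManifold (𝓡 m) 1 P := .of_le (n := ∞) (by norm_cast)
  rw [← dFun_comp_symmDeriv (chart_mem_atlas _ _) hy hf]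
  have hinv := isInvertible_mfderivWithin_extChartAt_symm (I := 𝓡 m) (x := x) (y := y)
    (by simpa using! hy)
  have h := hinv.self_apply_inverse (X ((chartAt (E m) x).symm y))
  have h0 : mfderivWithin (𝓡 m) (𝓡 m) (extChartAt (𝓡 m) x).symm (range (𝓡 m)) y =
      symmDeriv (chartAt (E m) x) y := by
    rw [ModelWithCorners.range_eq_univ, mfderivWithin_univ]
    rfl
  have h2 : symmDeriv (chartAt (E m) x) y (chartField x X y) = X ((chartAt (E m) x).symm y) := by
    rw [← h0]
    exact h
  exact congrArg (dFun f ((chartAt (E m) x).symm y)) h2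

theorem involutive_dFun {ι : Type*} [Fintype ι] {f : ι → P → ℝ} {U : Set P} (hU : IsOpen U)
    (hf : ∀ A, ContMDiffOn (𝓡 m) 𝓘(ℝ, ℝ) ∞ (f A) U) :
    Involutive (fun A => dFun (m := m) (f A)) U := by
  intro V hV hVU X Y hX hY h0X h0Y x hx
  have : IsManifold (𝓡 m) 1 P := .of_le (n := ∞) (by norm_cast)
  rw [mem_distribution]
  intro A
  set c := chartAt (E m) x
  have hc : c ∈ atlas (E m) P := chart_mem_atlas _ _
  have hxc : x ∈ c.source := mem_chart_source _ _
  have hcx : c.symm (c x) = x := c.left_inv hxc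
  have hfU : ∀ z ∈ U, ContMDiffAt (𝓡 m) 𝓘(ℝ, ℝ) ∞ (f A) z := fun z hz =>
      (hf A).contMDiffAt (hU.mem_nhds hz)
  have hev : ∀ Z : ∀ x : P, TangentSpace (𝓡 m) x,
      (∀ x ∈ V, Z x ∈ distribution (fun A => dFun (m := m) (f A)) x) →
      ∀ᶠ y in 𝓝 (c x), fderiv ℝ (f A ∘ c.symm) y (chartField x Z y) = 0 := by
    intro Z hZ
    filter_upwards [(isOpen_chart_preimage c hV).mem_nhds
        ⟨c.map_source hxc, by simpa [hcx] using hx⟩] with y hy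
    rw [fderiv_comp_symm_chartField hy.1 ((hfU _ (hVU hy.2)).mdifferentiableAt (by simp))]
    exact mem_distribution.1 (hZ _ hy.2) A
  have h1 := fderiv_lieBracket_eq_zero
    (contDiffAt_comp_symm hc (c.map_source hxc) (hfU _ (by rw [hcx]; exact hVU hx)))
    (differentiableAt_chartField hV hx hX) (differentiableAt_chartField hV hx hY)
    (hev X h0X) (hev Y h0Y)
  have h2 := fderiv_comp_symm_comp_mfderiv hc hxc ((hfU x (hVU hx)).mdifferentiableAt (by simp))
  -- `mlieBracket` is the flat bracket of the two chart fields, pulled back by the inverse of the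
  -- chart's derivative; applying that derivative undoes the pullback.
  have h3 : chartDeriv c x (VectorField.mlieBracket (𝓡 m) X Y x) =
      VectorField.lieBracket ℝ (chartField x X) (chartField x Y) (c x) := by
    have hs : (extChartAt (𝓡 m) x).symm ⁻¹' univ ∩ range (𝓡 m) = univ := by
      rw [preimage_univ, univ_inter, ModelWithCorners.range_eq_univ]
    have h4 : ∀ w : E m, _ := (isInvertible_mfderiv_extChartAt (I := 𝓡 m)
      (mem_extChartAt_source x)).self_apply_inverse
    refine Eq.trans (h4 (VectorField.lieBracketWithin ℝ (chartField x X) (chartField x Y)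
      ((extChartAt (𝓡 m) x).symm ⁻¹' univ ∩ range (𝓡 m)) (c x))) ?_
    rw [hs, VectorField.lieBracketWithin_univ]
  have h4 : fderiv ℝ (f A ∘ c.symm) (c x)
      (chartDeriv c x (VectorField.mlieBracket (𝓡 m) X Y x)) =
      dFun (f A) x (VectorField.mlieBracket (𝓡 m) X Y x) := DFunLike.congr_fun h2 _
  rw [h3, h1] at h4
  exact h4.symm

end Involution

/-! ### Consequences of an invertible commutation matrix -/

section Symplectic

open Matrix

variable {m : ℕ} {P : Type*} [TopologicalSpace P] [ChartedSpace (E m) P] {ι : Type*} [Fintype ι]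
  [DecidableEq ι] {Ω : SymplecticForm m P} {Φ : ι → P → ℝ} {z : P}

/-- Otherwise row `A` is zero and the determinant vanishes. -/
theorem exists_poisson_ne_zero (h : IsUnit (commutationMatrix Ω Φ z)) (A : ι) :
    ∃ B, poisson Ω (Φ A) (Φ B) z ≠ 0 := by
  by_contra! h0
  rw [Matrix.isUnit_iff_isUnit_det, Matrix.det_eq_zero_of_row_eq_zero A h0] at h
  simp at h

/-- The sum over the second index is an entry of `D⁻¹D = 1`, so the correction collapses to `{F,
Φ_A}`. This is pure matrix algebra, hence no regularity of `F` is needed. -/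
theorem diracBracket_constraint (h : IsUnit (commutationMatrix Ω Φ z)) (F : P → ℝ) (A : ι) :
    diracBracket Ω Φ F (Φ A) z = 0 := by
  rw [Matrix.isUnit_iff_isUnit_det] at h
  have h1 : ∀ B, ∑ C, poisson Ω F (Φ B) z * (commutationMatrix Ω Φ z)⁻¹ B C *
      poisson Ω (Φ C) (Φ A) z = poisson Ω F (Φ B) z * (1 : Matrix ι ι ℝ) B A := fun B => by
    rw [← Matrix.nonsing_inv_mul _ h, Matrix.mul_apply, Finset.mul_sum]
    exact Finset.sum_congr rfl fun C _ => mul_assoc _ _ _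
  simp [diracBracket, h1, Matrix.one_apply]

/-- Evaluating a relation `∑ c_A dΦ_A = 0` on the Hamiltonian vector of `Φ_B` gives row `B` of `D c
= 0`. -/
theorem linearIndependent_dFun (h : IsUnit (commutationMatrix Ω Φ z)) :
    LinearIndependent ℝ (fun A => dFun (m := m) (Φ A) z) := by
  rw [Fintype.linearIndependent_iff]
  intro c hc
  have h1 : commutationMatrix Ω Φ z *ᵥ c = 0 := by
    ext B
    have := DFunLike.congr_fun hc (hamiltonianVector Ω (Φ B) z)
    simpa [Matrix.mulVec, dotProduct, commutationMatrix, poisson, mul_comm] using this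
  exact congrFun (Matrix.mulVec_injective_of_isUnit h (h1.trans (Matrix.mulVec_zero _).symm))

/-- `Ω(v, ·)` vanishes on the common kernel of the `dΦ_A`, so it is a combination of them and `v` is
the same combination of Hamiltonian vectors. Since `v` itself lies in `Δ`, the coefficients satisfy
`c D = 0`. -/
theorem eq_zero_of_mem_distribution (h : IsUnit (commutationMatrix Ω Φ z))
    {v : TangentSpace (𝓡 m) z} (hv : v ∈ distribution (fun A => dFun (m := m) (Φ A)) z)
    (hw : ∀ w ∈ distribution (fun A => dFun (m := m) (Φ A)) z, Ω.form z ![v, w] = 0) : v = 0 := by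
  have h1 : Ω.flat z v ∈ Submodule.span ℝ (range fun A => (dFun (m := m) (Φ A) z).toLinearMap) := by
    refine mem_span_of_iInf_ker_le_ker fun w hw' => ?_
    exact hw w hw'
  obtain ⟨c, hc⟩ := (Submodule.mem_span_range_iff_exists_fun ℝ).1 h1
  have h2 : v = ∑ A, c A • hamiltonianVector Ω (Φ A) z := by
    apply Ω.flat_injective z
    rw [← hc, map_sum]
    refine Finset.sum_congr rfl fun A _ => ?_
    rw [map_smul]
    congr 1
    ext w
    exact (hamiltonianVector_spec Ω (Φ A) z w).symm
  have h3 : c ᵥ* commutationMatrix Ω Φ z = 0 := by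
    ext B
    have := mem_distribution.1 hv B
    rw [h2] at this
    simpa [Matrix.vecMul, dotProduct, commutationMatrix, poisson] using this
  have h4 : c = 0 := Matrix.vecMul_injective_of_isUnit h (h3.trans (Matrix.zero_vecMul _).symm)
  rw [h2, h4]
  simp

end Symplectic

/-! ### Dimension of the distribution -/

section Dimension

variable {ι : Type*} [Fintype ι]

/-- The common kernel of independent functionals has the complementary dimension. -/
theorem finrank_iInf_ker {V : Type*} [NormedAddCommGroup V] [NormedSpace ℝ V]
    [FiniteDimensional ℝ V] {θ : ι → V →L[ℝ] ℝ} (h : LinearIndependent ℝ θ) :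
    Module.finrank ℝ (⨅ A, (θ A).toLinearMap.ker : Submodule ℝ V) + Fintype.card ι =
      Module.finrank ℝ V := by
  have h1 : LinearIndependent ℝ (fun A => (θ A).toLinearMap) :=
    h.map' (ContinuousLinearMap.coeLM ℝ) (LinearMap.ker_eq_bot.2
      ContinuousLinearMap.coe_injective)
  have h2 := Subspace.finrank_add_finrank_dualCoannihilator_eq
    (Submodule.span ℝ (range fun A => (θ A).toLinearMap))
  have h3 : (Submodule.span ℝ (range fun A => (θ A).toLinearMap)).dualCoannihilator =
      ⨅ A, (θ A).toLinearMap.ker := by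
    ext v
    rw [← SetLike.mem_coe, Submodule.coe_dualCoannihilator_span]
    simp
  rw [h3, finrank_span_eq_card h1] at h2
  omega

/-- The distribution of independent Pfaffians has the complementary dimension. -/
theorem finrank_distribution {m : ℕ} {P : Type*} [TopologicalSpace P] [ChartedSpace (E m) P]
    {z : P} {θ : ι → CovectorField m P} (h : LinearIndependent ℝ (fun A => θ A z)) :
    Module.finrank ℝ (distribution θ z) + Fintype.card ι = m :=
  (finrank_iInf_ker (V := E m) h).trans (finrank_euclideanSpace_fin (𝕜 := ℝ))

end Dimension

/-! ### Inverse function theorem and completion to an isomorphism -/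

section InverseFunction

variable {V W : Type*} [NormedAddCommGroup V] [NormedSpace ℝ V] [CompleteSpace V]
  [NormedAddCommGroup W] [NormedSpace ℝ W]

/-- Inverse function theorem, with a smooth local inverse on a whole neighbourhood. -/
theorem exists_openPartialHomeomorph_of_contDiffOn {g : V → W} {s : Set V} (hs : IsOpen s)
    (hg : ContDiffOn ℝ ∞ g s) {x : V} (hx : x ∈ s) (e : V ≃L[ℝ] W) (he : fderiv ℝ g x = e) :
    ∃ Ψ : OpenPartialHomeomorph V W, x ∈ Ψ.source ∧ Ψ.source ⊆ s ∧ (∀ y, Ψ y = g y) ∧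
      ContDiffOn ℝ ∞ Ψ.symm Ψ.target := by
  have hgs : ∀ y ∈ s, ContDiffAt ℝ ∞ g y := fun y hy => hg.contDiffAt (hs.mem_nhds hy)
  have hder : HasFDerivAt g (e : V →L[ℝ] W) x :=
    he ▸ ((hgs x hx).differentiableAt (by simp)).hasFDerivAt
  -- The open locus in `s` where the derivative is invertible. Restricting to it makes the inverse
  -- smooth on the whole target, not only at the image of `x`.
  let D : Set V := s ∩ fderiv ℝ g ⁻¹' range ((↑) : (V ≃L[ℝ] W) → V →L[ℝ] W)
  have hD : IsOpen D := (hg.continuousOn_fderiv_of_isOpen hs (by simp)).isOpen_inter_preimage hs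
    ContinuousLinearEquiv.isOpen
  let Ψ₀ := (hgs x hx).toOpenPartialHomeomorph g hder (by simp)
  refine ⟨Ψ₀.restrOpen D hD, ⟨(hgs x hx).mem_toOpenPartialHomeomorph_source hder (by simp), hx,
    e, he.symm⟩, fun y hy => hy.2.1, fun y => rfl, fun y hy => ContDiffAt.contDiffWithinAt ?_⟩
  have hy' := (Ψ₀.restrOpen D hD).map_target hy
  obtain ⟨e', he'⟩ := hy'.2.2
  refine (Ψ₀.restrOpen D hD).contDiffAt_symm (f₀' := e') hy ?_ (hgs _ hy'.2.1)
  rw [he']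
  exact ((hgs _ hy'.2.1).differentiableAt (by simp)).hasFDerivAt

omit [CompleteSpace V] in
/-- A linear map whose kernel has dimension `k` can be completed to an isomorphism by `k`
coordinates. -/
theorem exists_complement_equiv [FiniteDimensional ℝ V] [FiniteDimensional ℝ W] {k : ℕ}
    (T : V →L[ℝ] W) (hk : Module.finrank ℝ T.toLinearMap.ker = k)
    (hd : k + Module.finrank ℝ W = Module.finrank ℝ V) :
    ∃ (R : V →L[ℝ] E k) (e : V ≃L[ℝ] E k × W), (e : V →L[ℝ] E k × W) = R.prod T := by
  -- `p` is a linear projection onto the kernel of `T`. On that kernel it is the identity, so `p`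
  -- and `T` have no common nonzero kernel vector.
  obtain ⟨p, hp⟩ := T.toLinearMap.ker.subtype.exists_leftInverse_of_injective
    (LinearMap.ker_eq_bot.2 (Submodule.subtype_injective _))
  let i : T.toLinearMap.ker ≃ₗ[ℝ] E k := LinearEquiv.ofFinrankEq _ _ (by simp [hk])
  let R : V →L[ℝ] E k := (i.toLinearMap ∘ₗ p).toContinuousLinearMap
  have hinj : Function.Injective (R.prod T).toLinearMap := by
    rw [← LinearMap.ker_eq_bot, LinearMap.ker_eq_bot']
    intro v hv
    have h1 : R v = 0 := congrArg Prod.fst hv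
    have h2 : T v = 0 := congrArg Prod.snd hv
    have h3 : p v = 0 := i.map_eq_zero_iff.1 h1
    have h4 := DFunLike.congr_fun hp ⟨v, h2⟩
    exact congrArg Subtype.val (h4.symm.trans h3)
  refine ⟨R, (LinearEquiv.ofInjectiveOfFinrankEq (R.prod T).toLinearMap hinj
    (by simp [← hd])).toContinuousLinearEquiv, ?_⟩
  ext v <;> rfl

end InverseFunction

/-! ### Smooth structure on a subset covered by slice charts -/

section Slices

variable {m k : ℕ} {P : Type*} [TopologicalSpace P] [ChartedSpace (E m) P] {S : Set P}
  {F : Type*} [NormedAddCommGroup F] [NormedSpace ℝ F]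

/-- `ψ` is a slice chart of `S`: in it, `S` is the preimage of `E k × {0}`. -/
def IsSliceChart (S : Set P) (a : (E k × F) ≃L[ℝ] E m) (ψ : OpenPartialHomeomorph P (E m)) : Prop :=
  ∀ p ∈ ψ.source, p ∈ S ↔ (a.symm (ψ p)).2 = 0

omit [ChartedSpace (E m) P] in
theorem IsSliceChart.apply_eq {a : (E k × F) ≃L[ℝ] E m} {ψ : OpenPartialHomeomorph P (E m)}
    (h : IsSliceChart S a ψ) {p : P} (hp : p ∈ ψ.source) (hpS : p ∈ S) :
    a ((a.symm (ψ p)).1, 0) = ψ p := by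
  rw [← (h p hp).1 hpS]
  simp

omit [ChartedSpace (E m) P] in
theorem IsSliceChart.symm_mem {a : (E k × F) ≃L[ℝ] E m} {ψ : OpenPartialHomeomorph P (E m)}
    (h : IsSliceChart S a ψ) {u : E k} (hu : a (u, 0) ∈ ψ.target) : ψ.symm (a (u, 0)) ∈ S := by
  rw [h _ (ψ.map_target hu), ψ.right_inv hu]
  simp

open Classical in
/-- The chart of `S` induced by a slice chart. -/
def sliceChart (a : (E k × F) ≃L[ℝ] E m) (ψ : OpenPartialHomeomorph P (E m))
    (h : IsSliceChart S a ψ) (z : S) : OpenPartialHomeomorph S (E k) where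
  toFun p := (a.symm (ψ p)).1
  -- The value `z` is a default that is never taken on the target, by `IsSliceChart.symm_mem`.
  invFun u := if hu : ψ.symm (a (u, 0)) ∈ S then ⟨_, hu⟩ else z
  source := Subtype.val ⁻¹' ψ.source
  target := (fun u => a (u, 0)) ⁻¹' ψ.target
  map_source' p hp := by
    change a ((a.symm (ψ p)).1, 0) ∈ ψ.target
    rw [h.apply_eq hp p.2]
    exact ψ.map_source hp
  map_target' u hu := by
    change (dite _ _ _ : S).1 ∈ ψ.source
    rw [dif_pos (h.symm_mem hu)]
    exact ψ.map_target hu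
  left_inv' p hp := by
    have h1 : ψ.symm (a ((a.symm (ψ p)).1, 0)) = p := by
      rw [h.apply_eq hp p.2, ψ.left_inv hp]
    have h2 : ψ.symm (a ((a.symm (ψ p)).1, 0)) ∈ S := by rw [h1]; exact p.2
    rw [dif_pos h2]
    exact Subtype.ext h1
  right_inv' u hu := by
    rw [dif_pos (h.symm_mem hu), ψ.right_inv hu]
    simp
  open_source := ψ.open_source.preimage continuous_subtype_val
  open_target := ψ.open_target.preimage (by fun_prop)
  continuousOn_toFun := by
    have h1 : ContinuousOn (fun p : S => ψ p) (Subtype.val ⁻¹' ψ.source) :=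
      ψ.continuousOn.comp continuous_subtype_val.continuousOn fun _ hp => hp
    exact (continuous_fst.comp a.symm.continuous).comp_continuousOn h1
  continuousOn_invFun := by
    rw [Topology.IsInducing.subtypeVal.continuousOn_iff]
    have h1 : ContinuousOn (fun u : E k => ψ.symm (a (u, 0))) ((fun u => a (u, 0)) ⁻¹' ψ.target) :=
      ψ.symm.continuousOn.comp (by fun_prop) fun _ hu => hu
    refine h1.congr fun u hu => ?_
    change (dite _ _ _ : S).1 = _
    rw [dif_pos (h.symm_mem hu)]

open Classical in
omit [ChartedSpace (E m) P] in
theorem coe_sliceChart_symm {a : (E k × F) ≃L[ℝ] E m} {ψ : OpenPartialHomeomorph P (E m)}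
    (h : IsSliceChart S a ψ) (z : S) {u : E k} (hu : a (u, 0) ∈ ψ.target) :
    ((sliceChart a ψ h z).symm u : P) = ψ.symm (a (u, 0)) := by
  change (dite _ _ _ : S).1 = _
  rw [dif_pos (h.symm_mem hu)]

/-- The smooth structure on `S` given by slice charts around its points. -/
abbrev sliceChartedSpace (a : (E k × F) ≃L[ℝ] E m) (ψ : S → OpenPartialHomeomorph P (E m))
    (h : ∀ z, IsSliceChart S a (ψ z)) (hz : ∀ z : S, (z : P) ∈ (ψ z).source) :
    ChartedSpace (E k) S where
  atlas := range fun z => sliceChart a (ψ z) (h z) z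
  chartAt z := sliceChart a (ψ z) (h z) z
  mem_chart_source := hz
  chart_mem_atlas z := ⟨z, rfl⟩

theorem isManifold_sliceChartedSpace (a : (E k × F) ≃L[ℝ] E m)
    (ψ : S → OpenPartialHomeomorph P (E m)) (h : ∀ z, IsSliceChart S a (ψ z))
    (hz : ∀ z : S, (z : P) ∈ (ψ z).source)
    (hψ : ∀ z, ψ z ∈ IsManifold.maximalAtlas (𝓡 m) ∞ P) :
    letI := sliceChartedSpace a ψ h hz
    IsManifold (𝓡 k) ∞ S := by
  let := sliceChartedSpace a ψ h hz
  refine isManifold_of_contDiffOn (𝓡 k) ∞ S ?_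
  rintro _ _ ⟨z, rfl⟩ ⟨z', rfl⟩
  rintro u ⟨⟨hu, hu'⟩, -⟩
  change a (u, 0) ∈ (ψ z).target at hu
  change ((sliceChart a (ψ z) (h z) z).symm u : P) ∈ (ψ z').source at hu'
  rw [coe_sliceChart_symm (h z) z hu] at hu'
  -- A transition map of `S` is an ambient one restricted to the slice `u ↦ a (u, 0)` and projected
  -- back to `E k`.
  have h1 : ContDiffAt ℝ ∞ (ψ z' ∘ (ψ z).symm) (a (u, 0)) :=
    ((contMDiffAt_of_mem_maximalAtlas (hψ z') hu').comp _
      (contMDiffAt_symm_of_mem_maximalAtlas (hψ z) hu)).contDiffAt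
  have h2 : ContDiffAt ℝ ∞ (fun u : E k => (a.symm ((ψ z' ∘ (ψ z).symm) (a (u, 0)))).1) u := by
    have h3 : ContDiffAt ℝ ∞ (fun u : E k => a (u, (0 : F))) u := by fun_prop
    have h4 : ContDiffAt ℝ ∞ (fun w : E m => (a.symm w).1)
        ((ψ z' ∘ (ψ z).symm) (a (u, 0))) := by fun_prop
    exact (h4.comp (a (u, 0)) h1).comp (f := fun u : E k => a (u, (0 : F))) u h3
  refine (h2.congr_of_eventuallyEq ?_).contDiffWithinAt
  filter_upwards [(sliceChart a (ψ z) (h z) z).open_target.mem_nhds hu] with v hv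
  change (a.symm (ψ z' ((sliceChart a (ψ z) (h z) z).symm v : P))).1 = _
  rw [coe_sliceChart_symm (h z) z hv]
  rfl

theorem isSmoothEmbedding_sliceChartedSpace (a : (E k × F) ≃L[ℝ] E m)
    (ψ : S → OpenPartialHomeomorph P (E m)) (h : ∀ z, IsSliceChart S a (ψ z))
    (hz : ∀ z : S, (z : P) ∈ (ψ z).source)
    (hψ : ∀ z, ψ z ∈ IsManifold.maximalAtlas (𝓡 m) ∞ P) :
    letI := sliceChartedSpace a ψ h hz
    IsSmoothEmbedding (𝓡 k) (𝓡 m) ∞ (Subtype.val : S → P) := by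
  let := sliceChartedSpace a ψ h hz
  have : IsManifold (𝓡 k) ∞ S := isManifold_sliceChartedSpace a ψ h hz hψ
  refine ⟨IsImmersionOfComplement.isImmersion (F := F) fun z => ?_, .subtypeVal⟩
  -- In these charts the inclusion is exactly `u ↦ a (u, 0)`, the normal form of an immersion with
  -- complement `F`.
  refine IsImmersionAtOfComplement.mk_of_charts a (chartAt (E k) z) (ψ z) (hz z) (hz z)
    (IsManifold.chart_mem_maximalAtlas z) (hψ z) (fun _ hp => hp) ?_
  intro u hu
  have hu' : a (u, 0) ∈ (ψ z).target := by
    simpa using! hu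
  change ψ z ((sliceChart a (ψ z) (h z) z).symm u : P) = a (u, 0)
  rw [coe_sliceChart_symm (h z) z hu', (ψ z).right_inv hu']

/-- The chart of `S` at `z` is the inclusion followed by a map differentiable on `P` at `z`. Its
derivative is invertible, so the first factor has injective derivative. -/
theorem mfderiv_subtypeVal_injective (a : (E k × F) ≃L[ℝ] E m)
    (ψ : S → OpenPartialHomeomorph P (E m)) (h : ∀ z, IsSliceChart S a (ψ z))
    (hz : ∀ z : S, (z : P) ∈ (ψ z).source)
    (hψ : ∀ z, ψ z ∈ IsManifold.maximalAtlas (𝓡 m) ∞ P) (z : S) :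
    letI := sliceChartedSpace a ψ h hz
    Function.Injective (mfderiv (𝓡 k) (𝓡 m) (Subtype.val : S → P) z) := by
  let := sliceChartedSpace a ψ h hz
  have : IsManifold (𝓡 k) ∞ S := isManifold_sliceChartedSpace a ψ h hz hψ
  have : IsManifold (𝓡 k) 1 S := .of_le (n := ∞) (by norm_cast)
  have h1 : MDifferentiableAt (𝓡 k) (𝓡 m) (Subtype.val : S → P) z :=
    ((isSmoothEmbedding_sliceChartedSpace a ψ h hz hψ).contMDiff z).mdifferentiableAt (by simp)
  have h2 : MDifferentiableAt (𝓡 m) (𝓡 k) (fun p => (a.symm (ψ z p)).1) (z : P) := by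
    have h3 := (contMDiffAt_of_mem_maximalAtlas (hψ z) (hz z)).mdifferentiableAt (by simp)
    have h4 : DifferentiableAt ℝ (fun w : E m => (a.symm w).1) (ψ z z) := by fun_prop
    exact h4.mdifferentiableAt.comp (z : P) h3
  have h5 := isInvertible_mfderiv_extChartAt (I := 𝓡 k) (mem_extChartAt_source (I := 𝓡 k) z)
  have h6 := mfderiv_comp z h2 h1
  intro v w hvw
  apply h5.injective
  change mfderiv (𝓡 k) (𝓡 k) ((fun p => (a.symm (ψ z p)).1) ∘ (Subtype.val : S → P)) z v =
    mfderiv (𝓡 k) (𝓡 k) ((fun p => (a.symm (ψ z p)).1) ∘ (Subtype.val : S → P)) z w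
  rw [h6]
  exact congrArg (mfderiv (𝓡 m) (𝓡 k) (fun p => (a.symm (ψ z p)).1) (z : P)) hvw

end Slices

/-! ### Level sets as maximal integral manifolds -/

section LevelSets

variable {m k : ℕ} {P : Type*} [TopologicalSpace P] [ChartedSpace (E m) P]
  [IsManifold (𝓡 m) ∞ P] {ι : Type*} [Fintype ι] {f : ι → P → ℝ} {U : Set P}

/-- In a chart, the functions are completed to a local diffeomorphism by `k` linear coordinates that
are an isomorphism on the kernel of their derivative. -/
theorem exists_isSliceChart (hU : IsOpen U) (hf : ∀ A, ContMDiffOn (𝓡 m) 𝓘(ℝ, ℝ) ∞ (f A) U)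
    (hk : k + Fintype.card ι = m) (a : (E k × (ι → ℝ)) ≃L[ℝ] E m) (c : ι → ℝ) {x : P} (hx : x ∈ U)
    (hli : LinearIndependent ℝ (fun A => dFun (m := m) (f A) x)) :
    ∃ ψ : OpenPartialHomeomorph P (E m), ψ ∈ IsManifold.maximalAtlas (𝓡 m) ∞ P ∧
      x ∈ ψ.source ∧ IsSliceChart {z ∈ U | ∀ A, f A z = c A} a ψ := by
  set e := chartAt (E m) x
  have he : e ∈ atlas (E m) P := chart_mem_atlas _ _
  have hxe : x ∈ e.source := mem_chart_source _ _
  have hex : e.symm (e x) = x := e.left_inv hxe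
  let s : Set (E m) := e.target ∩ e.symm ⁻¹' U
  have hs : IsOpen s := isOpen_chart_preimage e hU
  have hxs : e x ∈ s := ⟨e.map_source hxe, by simpa [hex] using hx⟩
  have hfU : ∀ A, ∀ z ∈ U, ContMDiffAt (𝓡 m) 𝓘(ℝ, ℝ) ∞ (f A) z := fun A z hz =>
    (hf A).contMDiffAt (hU.mem_nhds hz)
  let Φ : E m → ι → ℝ := fun y A => f A (e.symm y)
  have hΦ : ∀ y ∈ s, ContDiffAt ℝ ∞ Φ y := fun y hy =>
    contDiffAt_pi.2 fun A => contDiffAt_comp_symm he hy.1 (hfU A _ hy.2)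
  have hker : Module.finrank ℝ (fderiv ℝ Φ (e x)).toLinearMap.ker = k := by
    let θ : ι → E m →L[ℝ] ℝ := fun A => fderiv ℝ (f A ∘ e.symm) (e x)
    have h1 : LinearIndependent ℝ θ := by
      refine LinearIndependent.of_comp
        ((ContinuousLinearMap.compL ℝ (E m) (E m) ℝ).flip (chartDeriv e x)).toLinearMap ?_
      have h2 : (((ContinuousLinearMap.compL ℝ (E m) (E m) ℝ).flip
          (chartDeriv e x)).toLinearMap ∘ θ) = fun A => modelDFun (f A) x := funext fun A =>
        fderiv_comp_symm_comp_mfderiv he hxe ((hfU A x hx).mdifferentiableAt (by simp))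
      rw [h2]
      exact hli
    have h3 : (fderiv ℝ Φ (e x)).toLinearMap.ker = ⨅ A, (θ A).toLinearMap.ker := by
      ext v
      have h4 := fderiv_pi fun A =>
        differentiableAt_pi.1 ((hΦ _ hxs).differentiableAt (by simp)) A
      simp only [Submodule.mem_iInf, LinearMap.mem_ker, ContinuousLinearMap.coe_coe]
      rw [h4, funext_iff]
      rfl
    have h5 := finrank_iInf_ker h1
    rw [← h3, finrank_euclideanSpace_fin] at h5
    omega
  obtain ⟨R, i, hi⟩ := exists_complement_equiv (fderiv ℝ Φ (e x)) hker (by simp [hk])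
  -- Subtracting `c` places the level set at second coordinate `0`.
  let g : E m → E m := fun y => a (R y, Φ y - c)
  have hg : ContDiffOn ℝ ∞ g s := fun y hy => by
    have := hΦ y hy
    refine ContDiffAt.contDiffWithinAt ?_
    fun_prop
  have hgd : fderiv ℝ g (e x) = (i.trans a : E m ≃L[ℝ] E m) := by
    have h1 := (((hΦ _ hxs).differentiableAt (by simp)).hasFDerivAt).sub_const c
    have h2 := a.hasFDerivAt.comp (e x) (R.hasFDerivAt.prodMk h1)
    refine h2.fderiv.trans ?_
    rw [← hi]
    rfl
  obtain ⟨Ψ, hxΨ, hΨs, hΨg, hΨsymm⟩ :=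
    exists_openPartialHomeomorph_of_contDiffOn hs hg hxs (i.trans a) hgd
  have hΨ : ContDiffOn ℝ ∞ Ψ Ψ.source := (hg.mono hΨs).congr fun y _ => hΨg y
  have heM := IsManifold.subset_maximalAtlas (I := 𝓡 m) (n := ∞) he
  refine ⟨e.trans Ψ, OpenPartialHomeomorph.mem_maximalAtlas_of_contMDiffOn _ ?_ ?_,
    by simpa using! ⟨hxe, hxΨ⟩, ?_⟩
  · rintro p hp
    rw [OpenPartialHomeomorph.trans_source] at hp
    have h1 := (hΨ.contDiffAt (Ψ.open_source.mem_nhds hp.2)).contMDiffAt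
    exact (h1.comp p (contMDiffAt_of_mem_maximalAtlas heM hp.1)).contMDiffWithinAt
  · rintro y hy
    rw [OpenPartialHomeomorph.trans_target] at hy
    have h1 := (hΨsymm.contDiffAt (Ψ.open_target.mem_nhds hy.1)).contMDiffAt
    exact ((contMDiffAt_symm_of_mem_maximalAtlas heM hy.2).comp y h1).contMDiffWithinAt
  · intro p hp
    rw [OpenPartialHomeomorph.trans_source] at hp
    have h1 : e.symm (e p) = p := e.left_inv hp.1
    have hpU : p ∈ U := by
      have := (hΨs hp.2).2
      rwa [mem_preimage, h1] at this
    rw [OpenPartialHomeomorph.coe_trans, Function.comp_apply, hΨg]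
    simp only [g, ContinuousLinearEquiv.symm_apply_apply, sub_eq_zero, funext_iff, Φ, h1]
    exact ⟨fun h => h.2, fun h => ⟨hpU, h⟩⟩

/-- Level sets of functions with independent differentials are maximal integral manifolds. -/
theorem isMaximalIntegralManifold_levelSet (hU : IsOpen U)
    (hf : ∀ A, ContMDiffOn (𝓡 m) 𝓘(ℝ, ℝ) ∞ (f A) U) (hk : k + Fintype.card ι = m) (c : ι → ℝ)
    (hli : ∀ x ∈ U, LinearIndependent ℝ (fun A => dFun (m := m) (f A) x)) :
    IsMaximalIntegralManifold (fun A => dFun (m := m) (f A)) k {z ∈ U | ∀ A, f A z = c A} := by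
  -- One splitting of the model space serves all points, so that all slice charts share the same
  -- slice.
  let a : (E k × (ι → ℝ)) ≃L[ℝ] E m := ContinuousLinearEquiv.ofFinrankEq (by simp [hk])
  choose ψ hψ hz h using fun z : {z ∈ U | ∀ A, f A z = c A} =>
    exists_isSliceChart hU hf hk a c z.2.1 (hli z z.2.1)
  let := sliceChartedSpace a ψ h hz
  have hemb := isSmoothEmbedding_sliceChartedSpace a ψ h hz hψ
  refine ⟨hk, sliceChartedSpace a ψ h hz, isManifold_sliceChartedSpace a ψ h hz hψ, hemb,
    fun z => ?_⟩
  have hval : MDifferentiableAt (𝓡 k) (𝓡 m)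
      (Subtype.val : {z ∈ U | ∀ A, f A z = c A} → P) z :=
    (hemb.contMDiff z).mdifferentiableAt (by simp)
  -- The functions are constant on the level set, which gives inclusion in the distribution; both
  -- spaces have dimension `k`.
  refine Submodule.eq_of_le_of_finrank_eq ?_ ?_
  · rintro _ ⟨v, rfl⟩
    refine mem_distribution.2 fun A => ?_
    have h1 : MDifferentiableAt (𝓡 m) 𝓘(ℝ, ℝ) (f A) (z : P) :=
      ((hf A).contMDiffAt (hU.mem_nhds z.2.1)).mdifferentiableAt (by simp)
    have h2 := mfderiv_comp z h1 hval
    have h3 : f A ∘ (Subtype.val : {z ∈ U | ∀ A, f A z = c A} → P) = fun _ => c A :=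
      funext fun z => z.2.2 A
    rw [h3, mfderiv_const] at h2
    exact (DFunLike.congr_fun h2 v).symm
  · rw [LinearMap.finrank_range_of_inj (mfderiv_subtypeVal_injective a ψ h hz hψ z)]
    have h1 := finrank_distribution (hli z z.2.1)
    have h2 : Module.finrank ℝ (TangentSpace (𝓡 k) z) = k := finrank_euclideanSpace_fin (𝕜 := ℝ)
    omega

end LevelSets

end GaugeFixing

end

theorem corollary1 {N L : ℕ} {P : Type*} [TopologicalSpace P]
    [ChartedSpace (GaugeFixing.E (2 * N)) P] [IsManifold (𝓡 (2 * N)) ∞ P]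
    (T : GaugeFixing.HamiltonianGaugeTheory N L P) (G : GaugeFixing.CompleteGaugeFixing T)
    (hne : G.physicalPhaseSpace.Nonempty) :
    -- all constraints are second class, and strongly vanish in the Dirac bracket
    (∀ z ∈ G.U, ∀ A, ∃ B,
      GaugeFixing.poisson T.Ω (G.constraints A) (G.constraints B) z ≠ 0) ∧
    (∀ z ∈ G.U, ∀ (F : P → ℝ) (A),
      GaugeFixing.diracBracket T.Ω G.constraints F (G.constraints A) z = 0) ∧
    -- the exact Pfaffians are independent and generate a differential ideal
    GaugeFixing.PfaffiansIndependent G.pfaffians G.U ∧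
    GaugeFixing.GeneratesDifferentialIdeal G.pfaffians G.U ∧
    GaugeFixing.Involutive G.pfaffians G.U ∧
    -- the system is integrable, with `D` physical degrees of freedom
    ∃ D : ℕ, N = D + L ∧
      GaugeFixing.IsMaximalIntegralManifold G.pfaffians (2 * D) G.physicalPhaseSpace ∧
      (∀ z₀ ∈ G.U, GaugeFixing.IsMaximalIntegralManifold G.pfaffians (2 * D) (G.leaf z₀)) ∧
      -- the symplectic form is nondegenerate on the tangent spaces of the integral manifolds
      ∀ z ∈ G.U, ∀ v ∈ GaugeFixing.distribution G.pfaffians z,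
        (∀ w ∈ GaugeFixing.distribution G.pfaffians z, T.Ω.form z ![v, w] = 0) → v = 0 := by
  classical
  have hC : ∀ A, ContMDiffOn (𝓡 (2 * N)) 𝓘(ℝ, ℝ) ∞ (G.constraints A) G.U := by
    rintro (A | A)
    · exact (T.smooth_C A).contMDiffOn
    · exact G.smooth_S A
  have hinv : ∀ z ∈ G.U, IsUnit (GaugeFixing.commutationMatrix T.Ω G.constraints z) :=
    G.invertible
  have hli : GaugeFixing.PfaffiansIndependent G.pfaffians G.U := fun z hz =>
    GaugeFixing.linearIndependent_dFun (hinv z hz)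
  obtain ⟨z₁, hz₁, hz₁0⟩ := hne
  -- A point of `Σ_P` carries `2L` independent functionals on a `2N`-dimensional space. Hence `L ≤
  -- N`, and the natural subtraction `N - L` below is not truncated.
  have hdim := GaugeFixing.finrank_distribution (hli z₁ hz₁)
  rw [Fintype.card_sum, Fintype.card_fin] at hdim
  have hk : 2 * (N - L) + Fintype.card (Fin L ⊕ Fin L) = 2 * N := by
    rw [Fintype.card_sum, Fintype.card_fin]
    omega
  -- Both `Σ_P` and the leaves are level sets: `c = 0` gives the former, the constraint values at
  -- `z₀` the latter.
  have hlevel := fun c => GaugeFixing.isMaximalIntegralManifold_levelSet G.isOpen_U hC hk c hli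
  exact ⟨fun z hz => GaugeFixing.exists_poisson_ne_zero (hinv z hz),
    fun z hz => GaugeFixing.diracBracket_constraint (hinv z hz), hli,
    GaugeFixing.generatesDifferentialIdeal_dFun G.isOpen_U hC,
    GaugeFixing.involutive_dFun G.isOpen_U hC, N - L, by omega, hlevel fun _ => 0,
    fun z₀ _ => hlevel fun A => G.constraints A z₀,
    fun z hz _ hv hw => GaugeFixing.eq_zero_of_mem_distribution (hinv z hz) hv hw⟩
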